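/- Let $p\in(0,1]$ and $r\in(0,1)$ be fixed. For $n\ge 1$ let $G=\mathcal G^{r}_{n,p}$ be the \emph{Markov random graph} with initial probability $p$ and decay parameter $r$: the random graph on the vertices $v_1,\dots,v_n$ whose edge indicators $X^i_j$ ($1\le j<i\le n$; $X^i_j=1$ if $\{v_j,v_i\}$ is an edge, and $X^i_j=0$ otherwise) have the following joint law. The families $(X^i_1,\dots,X^i_{i-1})$, $2\le i\le n$, are independent of each other. For each $i$, the sequence $X^i_1,\dots,X^i_{i-1}$ is a Markov chain with $\mathbb P(X^i_1=1)=p$ whose transition probabilities, for $1\le j\le i-2$, are $$\mathbb P(X^i_{j+1}=1\mid X^i_j=0)=\mathbb P(X^i_j=1),\qquad \mathbb P(X^i_{j+1}=1\mid X^i_j=1)=r\,\mathbb P(X^i_j=1).$$ Let $\alpha(G)$ be the maximum cardinality of an independent set of $G$. \textbf{Theorem.} With high probability $\alpha(\mathcal G^{r}_{n,p})\le\left(e^{-r}+\frac{r}{10}\right)n$, that is, $$\lim_{n\to\infty}\mathbb P\left(\alpha(\mathcal G^{r}_{n,p})\le\left(e^{-r}+\tfrac{r}{10}\right)n\right)=1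 .$$ -/

import Mathlib

open MeasureTheory Filter Topology
open scoped ENNReal unitInterval

namespace MarkovGraph

/-- The law of a coin that shows `true` with probability `q`. -/
noncomputable def coin (q : ℝ≥0∞) (hq : q ≤ 1) : PMF Bool :=
  PMF.ofFintype (fun b => cond b q (1 - q)) (by simp [hq])

/-- The probability that the last entry of a random Boolean vector with law `μ` is `true`. -/
noncomputable def lastProb {m : ℕ} (μ : PMF (Fin (m + 1) → Bool)) : ℝ≥0∞ :=
  μ.map (fun x => x (Fin.last m)) true

theorem lastProb_le_one {m : ℕ} (μ : PMF (Fin (m + 1) → Bool)) : lastProb μ ≤ 1 :=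
  PMF.coe_le_one _ _

/-- The factor by which the edge probability is multiplied, according to whether the previous
edge is present: `r` if it is, and `1` if it is not. -/
noncomputable def decay (r : I) (b : Bool) : ℝ≥0∞ :=
  cond b (ENNReal.ofReal r) 1

theorem decay_le_one (r : I) (b : Bool) : decay r b ≤ 1 := by
  cases b
  · exact le_rfl
  · exact ENNReal.ofReal_le_one.2 r.2.2

/-- The joint law of the indicators of the edges from a vertex to the `m` vertices that precede it
(entry `j` is the edge to the `j`-th predecessor, counted from `0`). The first edge is present with
probability `p`. Given the edges so far, the next edge is present with probability `q` if the
last of them is absent, and with probability `r * q` if it is present, where `q` is the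
(unconditional) probability that the last of them is present. -/
noncomputable def edgeRow (p r : I) : (m : ℕ) → PMF (Fin m → Bool)
  | 0 => PMF.pure Fin.elim0
  | 1 => (coin (ENNReal.ofReal p) (ENNReal.ofReal_le_one.2 p.2.2)).map (fun b _ => b)
  | m + 2 =>
    (edgeRow p r (m + 1)).bind fun x =>
      (coin (decay r (x (Fin.last m)) * lastProb (edgeRow p r (m + 1)))
        (mul_le_one' (decay_le_one _ _) (lastProb_le_one _))).map
          fun b => (Fin.snoc x b : Fin (m + 2) → Bool)

/-- Edge configurations on `n` vertices: for each vertex `i` and each `j < i`, whether the edge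
`{j, i}` is present. -/
abbrev Config (n : ℕ) : Type := (i : Fin n) → (Fin i → Bool)

/-- The graph on `n` vertices described by a configuration. -/
def graph {n : ℕ} (ω : Config n) : SimpleGraph (Fin n) :=
  SimpleGraph.fromRel fun j i => ∃ h : j < i, ω i ⟨j, h⟩ = true

/-- The law of the Markov random graph on `n` vertices with initial probability `p` and decay
parameter `r`: the edges to the predecessors of a vertex follow `edgeRow`, independently for
distinct vertices. -/
noncomputable def law (p r : I) (n : ℕ) : Measure (Config n) :=
  Measure.pi fun i : Fin n => (edgeRow p r i).toMeasure

end MarkovGraph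

/-! The proof is a first-moment bound over all vertex sets. Let `q_m` be the probability of the edge
to index `m`. The chain gives `q_{m+1} = q_m (1 - (1 - r) q_m)`, hence `q_m ~ 1 / ((1 - r) m)`.
Dependence within a row costs little: given that a row has avoided a set so far, its next edge is
present with probability at least `hazard`, which has the same asymptotics (`avoidProb_succ_le`,
`tendsto_mul_hazard`).

So for any `θ < 1 / (1 - r)`, a set `S` of vertices beyond a constant index is independent with
probability at most `exp (-θ * pairWeight S)` (`law_independentConfigs_le`). Among sets of size `k`
the weight is least for the last `k` vertices, where it is about `n log (n / (n - k)) - k`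
(`le_pairWeight`). For `k` at least about `a n`, with `a = e^{-r} + r / 10`, this beats the `2 ^ n`
choices of `S` as soon as `-log (1 - a) - a > (1 - r) log 2`; `exists_tangent_point` proves a
tangent-line form of this. -/

namespace MarkovGraph

/-! ### Expectations over a single row and the recursion for the edge probabilities. -/

/-- The weights of a row are obtained by multiplying the weight of the initial part by the
transition probability. -/
theorem edgeRow_snoc (p r : I) (m : ℕ) (x : Fin (m + 1) → Bool) (b : Bool) :
    edgeRow p r (m + 2) (Fin.snoc x b : Fin (m + 2) → Bool) =
      edgeRow p r (m + 1) x *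
        coin (decay r (x (Fin.last m)) * lastProb (edgeRow p r (m + 1)))
          (mul_le_one' (decay_le_one _ _) (lastProb_le_one _)) b := by
  rw [edgeRow, PMF.bind_apply, tsum_eq_single x]
  · congr 1
    rw [PMF.map_apply, tsum_eq_single b]
    · simp
    · intro b' hb'
      rw [if_neg]
      intro h
      exact hb' (by simpa using (congrFun h (Fin.last (m + 1))).symm)
  · intro y hy
    convert mul_zero _
    rw [PMF.map_apply, ENNReal.tsum_eq_zero]
    intro b'
    rw [if_neg]
    intro h
    apply hy
    have h' := congrArg (fun z : Fin (m + 2) → Bool => Fin.init z) h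
    simpa using h'.symm

/-- The expectation of a function of a row. -/
noncomputable def rowMean (p r : I) (m : ℕ) (f : (Fin m → Bool) → ℝ) : ℝ :=
  ∑ x, (edgeRow p r m x).toReal * f x

/-- The probability that the edge to the vertex with index `m` is present. -/
noncomputable def edgeProb (p r : I) (m : ℕ) : ℝ :=
  (lastProb (edgeRow p r (m + 1))).toReal

theorem edgeProb_nonneg (p r : I) (m : ℕ) : 0 ≤ edgeProb p r m := ENNReal.toReal_nonneg

theorem edgeProb_le_one (p r : I) (m : ℕ) : edgeProb p r m ≤ 1 :=
  ENNReal.toReal_le_of_le_ofReal zero_le_one (by simpa using lastProb_le_one _)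

theorem decay_toReal (r : I) (b : Bool) : (decay r b).toReal = cond b (r : ℝ) 1 := by
  cases b
  · simp [decay]
  · simp [decay, r.2.1]

theorem coin_true_toReal (q : ℝ≥0∞) (hq : q ≤ 1) : (coin q hq true).toReal = q.toReal := by
  simp [coin]

theorem coin_false_toReal (q : ℝ≥0∞) (hq : q ≤ 1) : (coin q hq false).toReal = 1 - q.toReal := by
  simp [coin, ENNReal.toReal_sub_of_le hq]

theorem rowMean_succ (p r : I) (m : ℕ) (f : (Fin (m + 2) → Bool) → ℝ) :
    rowMean p r (m + 2) f = rowMean p r (m + 1) fun x =>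
      cond (x (Fin.last m)) (r : ℝ) 1 * edgeProb p r m * f (Fin.snoc x true : Fin (m + 2) → Bool) +
        (1 - cond (x (Fin.last m)) (r : ℝ) 1 * edgeProb p r m) *
          f (Fin.snoc x false : Fin (m + 2) → Bool) := by
  unfold rowMean
  rw [← (Fin.snocEquiv fun _ : Fin (m + 2) => Bool).sum_comp, Fintype.sum_prod_type_right]
  refine Finset.sum_congr rfl fun x _ => ?_
  rw [Fintype.sum_bool]
  simp only [Fin.snocEquiv, Equiv.coe_fn_mk]
  have h := edgeRow_snoc p r m x
  rw [h true, h false]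
  simp only [ENNReal.toReal_mul, coin_true_toReal, coin_false_toReal, decay_toReal, edgeProb]
  ring

theorem rowMean_nonneg (p r : I) (m : ℕ) {f : (Fin m → Bool) → ℝ} (hf : ∀ x, 0 ≤ f x) :
    0 ≤ rowMean p r m f :=
  Finset.sum_nonneg fun x _ => mul_nonneg ENNReal.toReal_nonneg (hf x)

theorem rowMean_mono (p r : I) (m : ℕ) {f g : (Fin m → Bool) → ℝ} (h : ∀ x, f x ≤ g x) :
    rowMean p r m f ≤ rowMean p r m g :=
  Finset.sum_le_sum fun x _ => mul_le_mul_of_nonneg_left (h x) ENNReal.toReal_nonneg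

theorem rowMean_add (p r : I) (m : ℕ) (f g : (Fin m → Bool) → ℝ) :
    rowMean p r m (fun x => f x + g x) = rowMean p r m f + rowMean p r m g := by
  simp [rowMean, mul_add, Finset.sum_add_distrib]

theorem rowMean_const_mul (p r : I) (m : ℕ) (c : ℝ) (f : (Fin m → Bool) → ℝ) :
    rowMean p r m (fun x => c * f x) = c * rowMean p r m f := by
  simp [rowMean, Finset.mul_sum, mul_left_comm]

theorem rowMean_one (p r : I) (m : ℕ) : rowMean p r m (fun _ => 1) = 1 := by
  have h := (edgeRow p r m).tsum_coe
  rw [tsum_fintype] at h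
  simp only [rowMean, mul_one]
  rw [← ENNReal.toReal_sum fun x _ => PMF.apply_ne_top _ _, h, ENNReal.toReal_one]

theorem edgeProb_eq_rowMean (p r : I) (m : ℕ) :
    edgeProb p r m = rowMean p r (m + 1) fun x => cond (x (Fin.last m)) 1 0 := by
  unfold edgeProb lastProb rowMean
  rw [PMF.map_apply, tsum_fintype, ENNReal.toReal_sum]
  · refine Finset.sum_congr rfl fun x _ => ?_
    cases h : x (Fin.last m) <;> simp [h]
  · intro x _
    split_ifs
    · exact PMF.apply_ne_top _ _
    · exact ENNReal.zero_ne_top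

theorem edgeProb_zero (p r : I) : edgeProb p r 0 = p := by
  unfold edgeProb lastProb
  rw [edgeRow, PMF.map_comp]
  have : ((fun x : Fin (0 + 1) → Bool => x (Fin.last 0)) ∘ fun (b : Bool) (_ : Fin 1) => b) = id :=
    rfl
  rw [this, PMF.map_id, coin_true_toReal, ENNReal.toReal_ofReal p.2.1]

/-- The transition step for the expectation of a function supported on rows whose last edge is
present. -/
theorem rowMean_last (p r : I) (m : ℕ) (f : (Fin (m + 1) → Bool) → ℝ) :
    rowMean p r (m + 1) (fun x => cond (x (Fin.last m)) (r : ℝ) 1 * edgeProb p r m * f x) =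
      edgeProb p r m * (rowMean p r (m + 1) f -
        (1 - r) * rowMean p r (m + 1) fun x => cond (x (Fin.last m)) (f x) 0) := by
  have : (fun x : Fin (m + 1) → Bool => cond (x (Fin.last m)) (r : ℝ) 1 * edgeProb p r m * f x) =
      fun x => edgeProb p r m * f x +
        (-(edgeProb p r m * (1 - r))) * cond (x (Fin.last m)) (f x) 0 := by
    funext x
    cases x (Fin.last m) <;> simp
    ring
  rw [this, rowMean_add, rowMean_const_mul, rowMean_const_mul]
  ring

theorem edgeProb_succ (p r : I) (m : ℕ) :
    edgeProb p r (m + 1) = edgeProb p r m * (1 - (1 - r) * edgeProb p r m) := by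
  rw [edgeProb_eq_rowMean p r (m + 1), rowMean_succ]
  have h := rowMean_last p r m fun _ => 1
  rw [rowMean_one, ← edgeProb_eq_rowMean] at h
  rw [← h]
  congr 1
  funext x
  simp

/-! ### The probability that a row avoids a given set. -/

/-- The indicator that none of the edges in `T` is present in a row. -/
noncomputable def avoids (T : Finset ℕ) {m : ℕ} (x : Fin m → Bool) : ℝ :=
  open Classical in if ∀ j : Fin m, (j : ℕ) ∈ T → x j = false then 1 else 0

theorem avoids_nonneg (T : Finset ℕ) {m : ℕ} (x : Fin m → Bool) : 0 ≤ avoids T x := by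
  unfold avoids; split_ifs <;> norm_num

theorem avoids_le_one (T : Finset ℕ) {m : ℕ} (x : Fin m → Bool) : avoids T x ≤ 1 := by
  unfold avoids; split_ifs <;> norm_num

theorem avoids_snoc (T : Finset ℕ) {m : ℕ} (x : Fin m → Bool) (b : Bool) :
    avoids T (Fin.snoc x b : Fin (m + 1) → Bool) =
      if m ∈ T ∧ b = true then 0 else avoids T x := by
  unfold avoids
  simp only [Fin.forall_fin_succ', Fin.snoc_castSucc, Fin.val_castSucc, Fin.snoc_last, Fin.val_last]
  cases b <;> by_cases h : m ∈ T <;> simp [h]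

/-- The probability that a row avoids `T`. -/
noncomputable def avoidProb (p r : I) (T : Finset ℕ) (m : ℕ) : ℝ :=
  rowMean p r m (avoids T)

/-- The probability that a row avoids `T` and its last edge is present. -/
noncomputable def avoidLastProb (p r : I) (T : Finset ℕ) (m : ℕ) : ℝ :=
  rowMean p r (m + 1) fun x => cond (x (Fin.last m)) (avoids T x) 0

theorem avoidProb_nonneg (p r : I) (T : Finset ℕ) (m : ℕ) : 0 ≤ avoidProb p r T m :=
  rowMean_nonneg _ _ _ (avoids_nonneg T)

theorem avoidProb_le_one (p r : I) (T : Finset ℕ) (m : ℕ) : avoidProb p r T m ≤ 1 :=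
  (rowMean_mono _ _ _ (avoids_le_one T)).trans_eq (rowMean_one _ _ _)

theorem avoidLastProb_nonneg (p r : I) (T : Finset ℕ) (m : ℕ) : 0 ≤ avoidLastProb p r T m :=
  rowMean_nonneg _ _ _ fun x => by cases x (Fin.last m) <;> simp [avoids_nonneg]

theorem avoidProb_succ_of_notMem (p r : I) {T : Finset ℕ} {m : ℕ} (h : m + 1 ∉ T) :
    avoidProb p r T (m + 2) = avoidProb p r T (m + 1) := by
  unfold avoidProb
  rw [rowMean_succ]
  congr 1
  funext x
  simp only [avoids_snoc, h, false_and, if_false]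
  ring

theorem avoidProb_succ_of_mem (p r : I) {T : Finset ℕ} {m : ℕ} (h : m + 1 ∈ T) :
    avoidProb p r T (m + 2) = avoidProb p r T (m + 1) -
      edgeProb p r m * (avoidProb p r T (m + 1) - (1 - r) * avoidLastProb p r T m) := by
  unfold avoidProb avoidLastProb
  rw [rowMean_succ, ← rowMean_last, sub_eq_add_neg, ← neg_one_mul, ← rowMean_const_mul,
    ← rowMean_add]
  congr 1
  funext x
  simp [avoids_snoc, h]
  ring

/-- An edge whose index lies in `T` cannot be present under avoidance; any other edge is present
with conditional probability at most `edgeProb p r m`, since both transition factors are at most 1.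
-/
theorem avoidLastProb_succ_le (p r : I) (T : Finset ℕ) (m : ℕ) :
    avoidLastProb p r T (m + 1) ≤ edgeProb p r m * avoidProb p r T (m + 2) := by
  by_cases h : m + 1 ∈ T
  · have : avoidLastProb p r T (m + 1) = 0 := by
      unfold avoidLastProb
      rw [rowMean_succ]
      simp [avoids_snoc, h, rowMean]
    rw [this]
    exact mul_nonneg (edgeProb_nonneg _ _ _) (avoidProb_nonneg _ _ _ _)
  · have : avoidLastProb p r T (m + 1) =
        edgeProb p r m * (avoidProb p r T (m + 1) - (1 - r) * avoidLastProb p r T m) := by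
      unfold avoidProb avoidLastProb
      rw [rowMean_succ, ← rowMean_last]
      simp [avoids_snoc, h]
    rw [this, avoidProb_succ_of_notMem p r h]
    refine mul_le_mul_of_nonneg_left ?_ (edgeProb_nonneg _ _ _)
    have := mul_nonneg (sub_nonneg.2 r.2.2) (avoidLastProb_nonneg p r T m)
    linarith

/-- A lower bound for the probability that the edge to the vertex with index `m + 2` is present,
given any event that concerns the edges to the vertices with index at most `m`. -/
noncomputable def hazard (p r : I) (m : ℕ) : ℝ :=
  edgeProb p r (m + 1) * (1 - (1 - r) * edgeProb p r m)

/-- Only the presence of the preceding edge lowers the next transition probability, and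
`avoidLastProb_succ_le` bounds how likely that is under avoidance. -/
theorem avoidProb_succ_le (p r : I) {T : Finset ℕ} {m : ℕ} (h : m + 2 ∈ T) :
    avoidProb p r T (m + 3) ≤ (1 - hazard p r m) * avoidProb p r T (m + 2) := by
  rw [avoidProb_succ_of_mem p r h, hazard]
  have h1 := avoidLastProb_succ_le p r T m
  have h2 := mul_nonneg (edgeProb_nonneg p r (m + 1)) (sub_nonneg.2 r.2.2)
  nlinarith [mul_le_mul_of_nonneg_left h1 h2]

theorem avoidProb_le_exp (p r : I) {θ : ℝ} {N : ℕ}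
    (hθ : ∀ m, N ≤ m → θ / (m + 3) ≤ hazard p r m) {T : Finset ℕ} (hT : ∀ j ∈ T, N + 2 ≤ j)
    (m : ℕ) :
    avoidProb p r T m ≤ Real.exp (-(θ * ∑ j ∈ T with j < m, 1 / ((j : ℝ) + 1))) := by
  induction m with
  | zero => simpa using avoidProb_le_one p r T 0
  | succ m ih =>
    by_cases h : m ∈ T
    · obtain ⟨k, rfl⟩ : ∃ k, m = k + 2 := ⟨m - 2, by have := hT m h; omega⟩
      have hk : N ≤ k := by have := hT _ h; omega
      have hfil : (T.filter fun j => j < k + 2 + 1) = insert (k + 2) (T.filter fun j => j < k + 2) := by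
        ext j
        simp only [Finset.mem_filter, Finset.mem_insert]
        constructor
        · rintro ⟨h1, h2⟩
          rcases Nat.lt_succ_iff_lt_or_eq.1 h2 with h3 | h3
          · exact Or.inr ⟨h1, h3⟩
          · exact Or.inl h3
        · rintro (rfl | ⟨h1, h2⟩)
          · exact ⟨h, by omega⟩
          · exact ⟨h1, by omega⟩
      rw [hfil, Finset.sum_insert (by simp), mul_add, neg_add, Real.exp_add]
      refine (avoidProb_succ_le p r h).trans ?_
      refine mul_le_mul ?_ ih (avoidProb_nonneg _ _ _ _) (Real.exp_pos _).le
      have h1 := hθ k hk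
      have h2 := Real.add_one_le_exp (-(θ * (1 / (((k + 2 : ℕ) : ℝ) + 1))))
      have h3 : θ * (1 / (((k + 2 : ℕ) : ℝ) + 1)) = θ / (k + 3) := by
        push_cast
        rw [mul_one_div]
        ring_nf
      rw [h3] at h2 ⊢
      linarith
    · have hfil : (T.filter fun j => j < m + 1) = T.filter fun j => j < m := by
        refine Finset.filter_congr fun j hj => ?_
        have : j ≠ m := fun e => h (e ▸ hj)
        omega
      rw [hfil]
      refine le_trans (le_of_eq ?_) ih
      -- Index 0 follows the initial law, not a transition; rows of length 0 and 1 avoid `T` surely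
      -- because its elements are at least 2.
      rcases m with _ | m
      · unfold avoidProb
        have : ∀ k, (∀ j ∈ T, k ≤ j) → rowMean p r k (avoids T) = 1 := by
          intro k hk
          rw [← rowMean_one p r k]
          congr 1
          funext x
          unfold avoids
          rw [if_pos]
          intro j hj
          have := hk _ hj
          omega
        rw [this _ (fun j hj => by have := hT j hj; omega), this _ (fun j hj => Nat.zero_le j)]
      · exact avoidProb_succ_of_notMem p r h

theorem toMeasure_avoids (p r : I) (T : Finset ℕ) (m : ℕ) :
    (edgeRow p r m).toMeasure {x | ∀ j : Fin m, (j : ℕ) ∈ T → x j = false} =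
      ENNReal.ofReal (avoidProb p r T m) := by
  classical
  rw [PMF.toMeasure_apply_fintype, avoidProb, rowMean, ENNReal.ofReal_sum_of_nonneg]
  · refine Finset.sum_congr rfl fun x _ => ?_
    unfold avoids
    by_cases h : ∀ j : Fin m, (j : ℕ) ∈ T → x j = false
    · rw [if_pos h, mul_one, ENNReal.ofReal_toReal (PMF.apply_ne_top _ _), Set.indicator_of_mem]
      exact h
    · rw [if_neg h, mul_zero, ENNReal.ofReal_zero, Set.indicator_of_notMem]
      exact h
  · exact fun x _ => mul_nonneg ENNReal.toReal_nonneg (avoids_nonneg T x)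

/-! ### Asymptotics of the edge probability. -/

theorem edgeProb_pos (p r : I) (hp : 0 < p) (hr0 : 0 < r) (m : ℕ) : 0 < edgeProb p r m := by
  induction m with
  | zero => rw [edgeProb_zero]; exact hp
  | succ m ih =>
    rw [edgeProb_succ]
    refine mul_pos ih ?_
    have h0 : (0 : ℝ) < r := hr0
    have h1 := mul_le_mul_of_nonneg_left (edgeProb_le_one p r m) (sub_nonneg.2 r.2.2)
    linarith

/-- Reciprocals turn the quadratic recursion into one with increments tending to `1 - r`; Cesàro
averaging then gives the growth rate. -/
theorem inv_edgeProb_succ (p r : I) (hp : 0 < p) (hr0 : 0 < r) (m : ℕ) :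
    (edgeProb p r (m + 1))⁻¹ =
      (edgeProb p r m)⁻¹ + (1 - r) / (1 - (1 - r) * edgeProb p r m) := by
  have h0 : (0 : ℝ) < r := hr0
  have h1 := mul_le_mul_of_nonneg_left (edgeProb_le_one p r m) (sub_nonneg.2 r.2.2)
  have h2 : 1 - (1 - (r : ℝ)) * edgeProb p r m ≠ 0 := by linarith
  have h3 := (edgeProb_pos p r hp hr0 m).ne'
  rw [edgeProb_succ, mul_inv, eq_comm, ← sub_eq_zero]
  generalize hd : 1 - (1 - (r : ℝ)) * edgeProb p r m = d at h2 ⊢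
  field_simp
  linarith

theorem tendsto_edgeProb_zero (p r : I) (hp : 0 < p) (hr0 : 0 < r) (hr1 : r < 1) :
    Tendsto (edgeProb p r) atTop (𝓝 0) := by
  have h0 : (0 : ℝ) < r := hr0
  have hr : (r : ℝ) < 1 := hr1
  have hlow : ∀ m : ℕ, (m : ℝ) * (1 - r) ≤ (edgeProb p r m)⁻¹ := by
    intro m
    induction m with
    | zero => simpa using edgeProb_nonneg p r 0
    | succ m ih =>
      rw [inv_edgeProb_succ p r hp hr0]
      have h1 := mul_le_mul_of_nonneg_left (edgeProb_le_one p r m) (sub_nonneg.2 r.2.2)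
      have h2 := mul_nonneg (sub_nonneg.2 r.2.2) (edgeProb_nonneg p r m)
      have h3 : 1 - (r : ℝ) ≤ (1 - r) / (1 - (1 - r) * edgeProb p r m) := by
        rw [le_div_iff₀ (by linarith)]
        nlinarith
      push_cast
      linarith
  have htop : Tendsto (fun m => (edgeProb p r m)⁻¹) atTop atTop :=
    tendsto_atTop_mono hlow (tendsto_natCast_atTop_atTop.atTop_mul_const (by linarith))
  exact htop.inv_tendsto_atTop.congr fun m => inv_inv _

theorem tendsto_inv_edgeProb_div (p r : I) (hp : 0 < p) (hr0 : 0 < r) (hr1 : r < 1) :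
    Tendsto (fun m : ℕ => (edgeProb p r m)⁻¹ / m) atTop (𝓝 (1 - r)) := by
  have hlim : Tendsto (fun m => (1 - (r : ℝ)) / (1 - (1 - r) * edgeProb p r m)) atTop
      (𝓝 (1 - r)) := by
    have h := ((tendsto_edgeProb_zero p r hp hr0 hr1).const_mul (1 - (r : ℝ))).const_sub 1
    have h' := (tendsto_const_nhds (x := 1 - (r : ℝ))).div h (by simp)
    rw [mul_zero, sub_zero, div_one] at h'
    exact h'
  have hsum : ∀ m, (edgeProb p r m)⁻¹ = (edgeProb p r 0)⁻¹ +
      ∑ i ∈ Finset.range m, (1 - (r : ℝ)) / (1 - (1 - r) * edgeProb p r i) := by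
    intro m
    induction m with
    | zero => simp
    | succ m ih => rw [inv_edgeProb_succ p r hp hr0, ih, Finset.sum_range_succ, add_assoc]
  have h := (tendsto_const_div_atTop_nhds_zero_nat (edgeProb p r 0)⁻¹).add hlim.cesaro
  rw [zero_add] at h
  refine h.congr fun m => ?_
  rw [hsum m]
  ring

theorem tendsto_mul_hazard (p r : I) (hp : 0 < p) (hr0 : 0 < r) (hr1 : r < 1) :
    Tendsto (fun m : ℕ => ((m : ℝ) + 3) * hazard p r m) atTop (𝓝 (1 - (r : ℝ))⁻¹) := by
  have hr : (r : ℝ) < 1 := hr1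
  have hinv : Tendsto (fun m : ℕ => ((m : ℝ) * edgeProb p r m)) atTop (𝓝 (1 - (r : ℝ))⁻¹) := by
    refine ((tendsto_inv_edgeProb_div p r hp hr0 hr1).inv₀ (by linarith)).congr fun m => ?_
    rw [inv_div, div_inv_eq_mul]
  have hq := tendsto_edgeProb_zero p r hp hr0 hr1
  -- The factor `m + 3` is split as `(m + 1) + 2` to match the index of `edgeProb p r (m + 1)`.
  have h1 := ((tendsto_add_atTop_iff_nat 1).2 hinv).add
    (((tendsto_add_atTop_iff_nat 1).2 hq).const_mul 2)
  have h2 := (hq.const_mul (1 - (r : ℝ))).const_sub 1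
  have h3 := h1.mul h2
  simp only [mul_zero, add_zero, sub_zero, mul_one] at h3
  refine h3.congr fun m => ?_
  unfold hazard
  push_cast
  ring

theorem exists_le_hazard (p r : I) (hp : 0 < p) (hr0 : 0 < r) (hr1 : r < 1) {θ : ℝ}
    (hθ : θ < (1 - (r : ℝ))⁻¹) : ∃ N : ℕ, ∀ m, N ≤ m → θ / (m + 3) ≤ hazard p r m := by
  obtain ⟨N, hN⟩ := eventually_atTop.1
    ((tendsto_mul_hazard p r hp hr0 hr1).eventually (lt_mem_nhds hθ))
  refine ⟨N, fun m hm => ?_⟩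
  rw [div_le_iff₀ (by positivity), mul_comm]
  exact (hN m hm).le

/-! ### Lower bounds for the weight of a vertex set. -/

/-- The sum of `1 / (j + 1)` over the pairs `j < i` of elements of `S`. -/
noncomputable def pairWeight (S : Finset ℕ) : ℝ :=
  ∑ i ∈ S, ∑ j ∈ S with j < i, 1 / ((j : ℝ) + 1)

theorem pairWeight_insert {a : ℕ} {S : Finset ℕ} (ha : ∀ x ∈ S, a < x) :
    pairWeight (insert a S) = S.card / ((a : ℝ) + 1) + pairWeight S := by
  have hmem : a ∉ S := fun h => lt_irrefl _ (ha a h)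
  unfold pairWeight
  rw [Finset.sum_insert hmem]
  have h0 : ((insert a S).filter fun j => j < a) = ∅ := by
    refine Finset.filter_eq_empty_iff.2 fun j hj => ?_
    rcases Finset.mem_insert.1 hj with rfl | hj
    · exact lt_irrefl _
    · exact (ha j hj).not_gt
  rw [h0, Finset.sum_empty, zero_add]
  have h1 : ∀ i ∈ S, ∑ j ∈ insert a S with j < i, 1 / ((j : ℝ) + 1) =
      1 / ((a : ℝ) + 1) + ∑ j ∈ S with j < i, 1 / ((j : ℝ) + 1) := by
    intro i hi
    rw [Finset.filter_insert, if_pos (ha i hi), Finset.sum_insert]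
    exact fun h => hmem (Finset.mem_filter.1 h).1
  rw [Finset.sum_congr rfl h1, Finset.sum_add_distrib, Finset.sum_const, nsmul_eq_mul, mul_one_div]

theorem card_le_sub_of_forall_gt {a n : ℕ} {S : Finset ℕ} (ha : ∀ x ∈ S, a < x)
    (hS : ∀ x ∈ S, x < n) : S.card ≤ n - (a + 1) := by
  rw [← Nat.card_Ico]
  exact Finset.card_le_card fun x hx => Finset.mem_Ico.2 ⟨ha x hx, hS x hx⟩

/-- A new minimum `a` below `k` elements adds `k / (a + 1)`, which is at least `k / (n - k) = n / (n
- k) - 1` because the elements fit below `n`. The sum telescopes against the logarithm; `n + 1`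
keeps its argument positive when the set has `n` elements. -/
theorem le_pairWeight (n : ℕ) (S : Finset ℕ) (hS : ∀ x ∈ S, x < n) :
    n * (Real.log (n + 1) - Real.log (n + 1 - S.card)) - S.card ≤ pairWeight S := by
  induction S using Finset.induction_on_min with
  | empty => simp [pairWeight]
  | insert a S ha ih =>
    have hmem : a ∉ S := fun h => lt_irrefl _ (ha a h)
    have han : a < n := hS a (Finset.mem_insert_self _ _)
    have hc := card_le_sub_of_forall_gt ha fun x hx => hS x (Finset.mem_insert_of_mem hx)
    have hc' : (a : ℝ) + 1 ≤ n - S.card := by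
      have : a + 1 + S.card ≤ n := by omega
      have : ((a + 1 + S.card : ℕ) : ℝ) ≤ n := by exact_mod_cast this
      push_cast at this
      linarith
    have ih' := ih fun x hx => hS x (Finset.mem_insert_of_mem hx)
    rw [pairWeight_insert ha, Finset.card_insert_of_notMem hmem]
    have hpos : (0 : ℝ) < (a : ℝ) + 1 := by positivity
    set k : ℝ := (S.card : ℝ) with hk
    have hk0 : 0 ≤ k := by positivity
    have hd : 0 < (n : ℝ) - k := by linarith
    have h1 : k / (n - k) ≤ k / (a + 1) := div_le_div_of_nonneg_left hk0 hpos hc'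
    have h2 : Real.log (n + 1 - k) - Real.log (n - k) ≤ 1 / (n - k) := by
      rw [← Real.log_div (by linarith) hd.ne']
      refine (Real.log_le_sub_one_of_pos (div_pos (by linarith) hd)).trans_eq ?_
      field_simp
      ring
    have h3 : (n : ℝ) * (1 / (n - k)) = k / (n - k) + 1 := by
      field_simp
      ring
    have h4 := mul_le_mul_of_nonneg_left h2 (Nat.cast_nonneg (α := ℝ) n)
    rw [h3] at h4
    push_cast
    rw [← hk, show (n : ℝ) + 1 - (k + 1) = n - k by ring]
    linarith

/-- A linear lower bound for `pairWeight`, from the tangent of the logarithm at `b`. -/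
theorem le_pairWeight_linear (n : ℕ) (S : Finset ℕ) (hS : ∀ x ∈ S, x < n) {b : ℝ} (hb : 0 < b) :
    n * (1 - Real.log b - 1 / b) + S.card * (1 / b - 1) - 1 / b ≤ pairWeight S := by
  refine le_trans ?_ (le_pairWeight n S hS)
  have hcard : (S.card : ℝ) ≤ n := by
    have : S.card ≤ (Finset.range n).card :=
      Finset.card_le_card fun x hx => Finset.mem_range.2 (hS x hx)
    rw [Finset.card_range] at this
    exact_mod_cast this
  set k : ℝ := (S.card : ℝ)
  have hn1 : (0 : ℝ) < n + 1 := by positivity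
  have hk1 : (0 : ℝ) < n + 1 - k := by linarith
  have h := Real.log_le_sub_one_of_pos (x := (n + 1 - k) / (n + 1) / b) (by positivity)
  rw [Real.log_div (by positivity) hb.ne', Real.log_div hk1.ne' hn1.ne'] at h
  have h' := mul_le_mul_of_nonneg_left h (Nat.cast_nonneg (α := ℝ) n)
  have h2 : (n : ℝ) * ((n + 1 - k) / (n + 1) / b) ≤ (n + 1 - k) / b := by
    rw [div_div, ← mul_div_assoc, div_le_div_iff₀ (by positivity) hb]
    have := mul_pos hk1 hb
    nlinarith
  have h3 : (n + 1 - k) / b = n * (1 / b) + 1 / b - k * (1 / b) := by ring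
  rw [h3] at h2
  linarith

/-! ### The numerical inequality. -/

theorem cubic_le_exp_neg {r : ℝ} (h0 : 0 ≤ r) (h1 : r ≤ 1) :
    1 - r + r ^ 2 / 2 - r ^ 3 / 6 ≤ Real.exp (-r) := by
  have h := Real.exp_bound (x := -r) (by rw [abs_neg, abs_of_nonneg h0]; exact h1)
    (n := 5) (by norm_num)
  rw [abs_neg, abs_of_nonneg h0] at h
  have h2 := (abs_le.1 h).1
  simp only [Finset.sum_range_succ, Finset.sum_range_zero, Nat.factorial] at h2
  norm_num at h2
  have h3 : r ^ 5 ≤ r ^ 4 := pow_le_pow_of_le_one h0 h1 (by norm_num)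
  have h4 : 0 ≤ r ^ 4 := by positivity
  have e3 : (-r) ^ 3 = -r ^ 3 := by ring
  rw [e3] at h2
  linarith

/-- The tangent point stands in for `1 - a`, where `a = e^{-r} + r / 10`, and two values suffice.
For `b = 1 / 4` the claim reads `3 a + (1 + r) log 2 > 3`; for `b = 1 / 2` it reads `a + r log 2 >
1`. Both follow from the cubic bound on `e^{-r}`, with little room at `r = 1 / 2`. -/
theorem exists_tangent_point {r : ℝ} (h0 : 0 < r) (h1 : r < 1) :
    ∃ b : ℝ, 0 < b ∧ b ≤ 1 ∧ (1 - r) * Real.log 2 <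
      1 - Real.log b - 1 / b + (Real.exp (-r) + r / 10) * (1 / b - 1) := by
  have he := cubic_le_exp_neg h0.le h1.le
  have hl := Real.log_two_gt_d9
  rcases le_total r (1 / 2) with h | h
  · refine ⟨1 / 4, by norm_num, by norm_num, ?_⟩
    have : Real.log (1 / 4) = -(2 * Real.log 2) := by
      rw [one_div, Real.log_inv, show (4 : ℝ) = 2 ^ 2 by norm_num, Real.log_pow]
      norm_num
    rw [this]
    norm_num
    have h2 : 0.6931471803 * (1 + r) ≤ Real.log 2 * (1 + r) :=
      mul_le_mul_of_nonneg_right hl.le (by linarith)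
    nlinarith [mul_nonneg h0.le (sub_nonneg.2 h), mul_nonneg (sq_nonneg r) (sub_nonneg.2 h),
      mul_nonneg (sq_nonneg (r - 1 / 2)) h0.le, mul_nonneg (sq_nonneg (r - 1 / 2)) (sub_nonneg.2 h)]
  · refine ⟨1 / 2, by norm_num, by norm_num, ?_⟩
    have : Real.log (1 / 2) = -Real.log 2 := by rw [one_div, Real.log_inv]
    rw [this]
    norm_num
    have h2 : 0.6931471803 * r ≤ Real.log 2 * r := mul_le_mul_of_nonneg_right hl.le h0.le
    have h3 : 0 ≤ r * ((r - 1 / 2) * (1 - r)) :=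
      mul_nonneg h0.le (mul_nonneg (by linarith) (by linarith))
    nlinarith [mul_nonneg h0.le (sub_nonneg.2 h)]

/-! ### The union bound. -/

instance isProbabilityMeasure_law (p r : I) (n : ℕ) : IsProbabilityMeasure (law p r n) := by
  unfold law
  infer_instance

/-- The configurations for which the vertices in `S` are pairwise not adjacent. -/
def independentConfigs (n : ℕ) (S : Finset ℕ) : Set (Config n) :=
  {ω | ∀ i : Fin n, (i : ℕ) ∈ S → ∀ j : Fin i, (j : ℕ) ∈ S → ω i j = false}

theorem law_independentConfigs_le (p r : I) {θ : ℝ} {N : ℕ}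
    (hθ : ∀ m, N ≤ m → θ / (m + 3) ≤ hazard p r m) (n : ℕ) {S : Finset ℕ}
    (hS : ∀ j ∈ S, N + 2 ≤ j) (hn : ∀ j ∈ S, j < n) :
    law p r n (independentConfigs n S) ≤ ENNReal.ofReal (Real.exp (-(θ * pairWeight S))) := by
  classical
  -- Independence of `S` is a product event: row `i` must avoid `S` if `i ∈ S` and is unconstrained
  -- otherwise.
  have heq : independentConfigs n S = Set.pi Set.univ fun i : Fin n =>
      {x : Fin i → Bool | ∀ j : Fin i, (j : ℕ) ∈ (if (i : ℕ) ∈ S then S else ∅) → x j = false} := by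
    ext ω
    simp only [independentConfigs, Set.mem_ofPred_eq, Set.mem_pi, Set.mem_univ, true_imp_iff]
    refine forall_congr' fun i => ?_
    by_cases hi : (i : ℕ) ∈ S <;> simp [hi]
  have hrow : ∀ i : Fin n, avoidProb p r (if (i : ℕ) ∈ S then S else ∅) i ≤
      Real.exp (-(θ * if (i : ℕ) ∈ S then ∑ j ∈ S with j < (i : ℕ), 1 / ((j : ℝ) + 1) else 0)) := by
    intro i
    by_cases hi : (i : ℕ) ∈ S
    · simp only [if_pos hi]
      exact avoidProb_le_exp p r hθ hS i
    · simpa only [if_neg hi, mul_zero, neg_zero, Real.exp_zero] using avoidProb_le_one p r ∅ i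
  have hsum : pairWeight S = ∑ i : Fin n,
      if (i : ℕ) ∈ S then ∑ j ∈ S with j < (i : ℕ), 1 / ((j : ℝ) + 1) else 0 := by
    rw [Fin.sum_univ_eq_sum_range
      (fun i => if i ∈ S then ∑ j ∈ S with j < i, 1 / ((j : ℝ) + 1) else 0) n,
      ← Finset.sum_filter, pairWeight]
    refine Finset.sum_congr ?_ fun _ _ => rfl
    ext i
    simp only [Finset.mem_filter, Finset.mem_range]
    exact ⟨fun h => ⟨hn i h, h⟩, fun h => h.2⟩
  rw [heq, law, Measure.pi_pi]
  simp only [toMeasure_avoids]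
  rw [← ENNReal.ofReal_prod_of_nonneg fun i _ => avoidProb_nonneg _ _ _ _]
  refine ENNReal.ofReal_le_ofReal ?_
  refine (Finset.prod_le_prod (fun i _ => avoidProb_nonneg _ _ _ _) fun i _ => hrow i).trans_eq ?_
  rw [← Real.exp_sum, Finset.sum_neg_distrib, ← Finset.mul_sum, hsum]

/-- An independent set yields, after the removal of the vertices with index less than `N`, a set
of the union bound. -/
theorem exists_mem_independentConfigs {n : ℕ} (N : ℕ) (ω : Config n) :
    ∃ S ∈ (Finset.range n).powerset, (∀ j ∈ S, N ≤ j) ∧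
      (graph ω).indepNum ≤ S.card + N ∧ ω ∈ independentConfigs n S := by
  classical
  obtain ⟨s, hs⟩ := (graph ω).exists_isNIndepSet_indepNum
  refine ⟨(s.map Fin.valEmbedding).filter (N ≤ ·), ?_, ?_, ?_, ?_⟩
  · rw [Finset.mem_powerset]
    intro j hj
    obtain ⟨i, _, rfl⟩ := Finset.mem_map.1 (Finset.mem_filter.1 hj).1
    exact Finset.mem_range.2 i.2
  · exact fun j hj => (Finset.mem_filter.1 hj).2
  · rw [← hs.card_eq, ← Finset.card_map Fin.valEmbedding,
      ← Finset.card_filter_add_card_filter_not (s := s.map Fin.valEmbedding) (N ≤ ·)]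
    refine Nat.add_le_add_left ?_ _
    refine (Finset.card_le_card (t := Finset.range N) fun j hj => ?_).trans_eq
      (Finset.card_range N)
    exact Finset.mem_range.2 (not_le.1 (Finset.mem_filter.1 hj).2)
  · intro i hi j hj
    obtain ⟨i', hi', hii⟩ := Finset.mem_map.1 (Finset.mem_filter.1 hi).1
    obtain ⟨j', hj', hjj⟩ := Finset.mem_map.1 (Finset.mem_filter.1 hj).1
    obtain rfl : i' = i := Fin.ext hii
    have hji : j' < i' := by
      rw [Fin.lt_def, show (j' : ℕ) = j from hjj]
      exact j.2
    have hind := hs.isIndepSet hj' hi' hji.ne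
    by_contra hne
    refine hind ?_
    rw [graph, SimpleGraph.fromRel_adj]
    refine ⟨hji.ne, Or.inl ⟨hji, ?_⟩⟩
    have : (⟨j', hji⟩ : Fin i') = j := Fin.ext hjj
    rw [this]
    simpa using hne

/-- Discarding the first `N + 2` vertices, where the hazard bound may fail, costs only a constant in
the exponent. The condition `b ≤ 1` makes the linear bound on the weight nondecreasing in the size
of the set. -/
theorem law_indepNum_gt_le (p r : I) {θ b a : ℝ} {N : ℕ} (hθ0 : 0 ≤ θ)
    (hθ : ∀ m, N ≤ m → θ / (m + 3) ≤ hazard p r m) (hb : 0 < b) (hb1 : b ≤ 1) (n : ℕ) :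
    law p r n {ω | a * n < ((graph ω).indepNum : ℝ)} ≤ ENNReal.ofReal
      (Real.exp (θ * ((N + 2) * (1 / b - 1) + 1 / b) -
        n * (θ * (1 - Real.log b - 1 / b + a * (1 / b - 1)) - Real.log 2))) := by
  classical
  set F := (Finset.range n).powerset.filter fun S =>
    (∀ j ∈ S, N + 2 ≤ j) ∧ a * n ≤ S.card + (N + 2 : ℝ)
  have hsub : {ω : Config n | a * n < ((graph ω).indepNum : ℝ)} ⊆
      ⋃ S ∈ F, independentConfigs n S := by
    intro ω hω
    obtain ⟨S, hS, hN, hc, hmem⟩ := exists_mem_independentConfigs (N + 2) ω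
    refine Set.mem_biUnion (x := S) (Finset.mem_filter.2 ⟨hS, hN, ?_⟩) hmem
    have hc' : ((graph ω).indepNum : ℝ) ≤ ((S.card + (N + 2) : ℕ) : ℝ) := by exact_mod_cast hc
    push_cast at hc'
    exact (le_of_lt hω).trans hc'
  set E : ℝ := n * (1 - Real.log b - 1 / b + a * (1 / b - 1)) -
    ((N + 2) * (1 / b - 1) + 1 / b) with hE
  have hF : ∀ S ∈ F, law p r n (independentConfigs n S) ≤
      ENNReal.ofReal (Real.exp (-(θ * E))) := by
    intro S hS
    obtain ⟨h1, h2, h3⟩ := Finset.mem_filter.1 hS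
    have hn : ∀ j ∈ S, j < n := fun j hj => Finset.mem_range.1 (Finset.mem_powerset.1 h1 hj)
    refine (law_independentConfigs_le p r hθ n h2 hn).trans (ENNReal.ofReal_le_ofReal ?_)
    rw [Real.exp_le_exp, neg_le_neg_iff]
    refine mul_le_mul_of_nonneg_left (le_trans ?_ (le_pairWeight_linear n S hn hb)) hθ0
    have hb' : 0 ≤ 1 / b - 1 := sub_nonneg.2 ((le_div_iff₀ hb).2 (by linarith))
    have := mul_le_mul_of_nonneg_right h3 hb'
    rw [hE]
    linarith
  have hcard : (F.card : ℝ≥0∞) ≤ ENNReal.ofReal (Real.exp (n * Real.log 2)) := by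
    have h : F.card ≤ 2 ^ n := by
      refine (Finset.card_filter_le _ _).trans_eq ?_
      rw [Finset.card_powerset, Finset.card_range]
    rw [mul_comm, Real.exp_mul, Real.exp_log two_pos, Real.rpow_natCast,
      ENNReal.ofReal_pow two_pos.le, ENNReal.ofReal_ofNat]
    exact_mod_cast h
  calc law p r n {ω | a * n < ((graph ω).indepNum : ℝ)}
      ≤ ∑ S ∈ F, law p r n (independentConfigs n S) :=
        (measure_mono hsub).trans (measure_biUnion_finset_le _ _)
    _ ≤ F.card • ENNReal.ofReal (Real.exp (-(θ * E))) := Finset.sum_le_card_nsmul _ _ _ hF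
    _ ≤ ENNReal.ofReal (Real.exp (n * Real.log 2)) * ENNReal.ofReal (Real.exp (-(θ * E))) := by
        rw [nsmul_eq_mul]
        gcongr
    _ = _ := by
        rw [← ENNReal.ofReal_mul (Real.exp_pos _).le, ← Real.exp_add, hE]
        congr 2
        ring

theorem tendsto_law_indepNum_gt (p r : I) (hp : 0 < p) (hr0 : 0 < r) (hr1 : r < 1) :
    Tendsto (fun n : ℕ => law p r n {ω | (Real.exp (-(r : ℝ)) + (r : ℝ) / 10) * n <
      ((graph ω).indepNum : ℝ)}) atTop (𝓝 0) := by
  have hr : 0 < 1 - (r : ℝ) := sub_pos.2 hr1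
  obtain ⟨b, hb, hb1, hK⟩ := exists_tangent_point (r := r) hr0 hr1
  set K := 1 - Real.log b - 1 / b + (Real.exp (-(r : ℝ)) + (r : ℝ) / 10) * (1 / b - 1)
  have hlog : 0 < Real.log 2 := Real.log_pos one_lt_two
  have hKpos : 0 < K := (mul_pos hr hlog).trans hK
  obtain ⟨θ, hθ1, hθ2⟩ : ∃ θ, Real.log 2 / K < θ ∧ θ < (1 - (r : ℝ))⁻¹ := by
    -- The interval for `θ` is nonempty precisely because `(1 - r) log 2 < K`: its lower end beats
    -- the count `2 ^ n`, its upper end is the limit of the scaled hazard.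
    refine exists_between ?_
    rw [div_lt_iff₀ hKpos, inv_mul_eq_div, lt_div_iff₀ hr]
    linarith
  have hθ0 : 0 ≤ θ := ((div_pos hlog hKpos).trans hθ1).le
  obtain ⟨N, hN⟩ := exists_le_hazard p r hp hr0 hr1 hθ2
  have hpos : 0 < θ * K - Real.log 2 := by
    rw [div_lt_iff₀ hKpos] at hθ1
    linarith
  refine tendsto_of_tendsto_of_tendsto_of_le_of_le tendsto_const_nhds ?_ (fun _ => zero_le)
    (law_indepNum_gt_le p r hθ0 hN hb hb1)
  rw [← ENNReal.ofReal_zero]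
  refine ENNReal.tendsto_ofReal (Real.tendsto_exp_atBot.comp ?_)
  exact tendsto_const_nhds.add_atBot (tendsto_neg_atTop_atBot.comp
    (tendsto_natCast_atTop_atTop.atTop_mul_const hpos))

end MarkovGraph

theorem mainTheorem5 (p r : I) (hp : 0 < p) (hr0 : 0 < r) (hr1 : r < 1) :
    Tendsto
      (fun n : ℕ => MarkovGraph.law p r n
        {ω | ((MarkovGraph.graph ω).indepNum : ℝ) ≤
          (Real.exp (-(r : ℝ)) + (r : ℝ) / 10) * (n : ℝ)})
      atTop (𝓝 1) := by
  have h := ENNReal.Tendsto.sub (tendsto_const_nhds (x := (1 : ℝ≥0∞)))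
    (MarkovGraph.tendsto_law_indepNum_gt p r hp hr0 hr1) (Or.inl ENNReal.one_ne_top)
  rw [tsub_zero] at h
  refine h.congr fun n => ?_
  rw [← prob_compl_eq_one_sub (Set.toFinite _).measurableSet]
  congr 1
  ext ω
  simp
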